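/- Let \[ W=\begin{pmatrix}0&0&0&-1\\1&0&0&8\\0&1&0&-6\\0&0&1&8\end{pmatrix}\in GL(4,\mathbb{Z}), \] and let $F_W\colon\mathbb{T}^4\to\mathbb{T}^4$ be the automorphism of $\mathbb{T}^4=\mathbb{R}^4/\mathbb{Z}^4$ to which the linear action of $W$ on $\mathbb{R}^4$ projects. Let $\mu$ be Lebesgue measure on $\mathbb{T}^4$, normalized to be a probability measure. Then $\mu$ is $F_W$-invariant and multiply mixing: for every $N\in\mathbb{N}$ and all $\varphi_1,\dots,\varphi_N\in L^\infty(\mu)$, \[ \prod_{i=1}^N\varphi_i\circ F_W^{\,n_1+\dots+n_i}\longrightarrow\prod_{i=1}^N\int\varphi_i\,d\mu \quad\text{weakly in }L^2(\mu)\text{ as } n_1,\dots,n_N\to\infty , \] that is, for every $\psi\in L^2(\mu)$ and every $\varepsilon>0$ there is a $K$ such that \[ \left|\int\psi\prod_{i=1}^N\varphi_i\circ F_W^{\,n_1+\dots+n_i}\,d\mu-\prod_{i=1}^N\int\varphi_i\,d\mu\int\psi\,d\mu\right|<\varepsilon \] whenever $n_i\ge K$ for all $1\le i\le N$. -/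

import Mathlib

open MeasureTheory Filter Topology
open scoped ENNReal MatrixGroups

/-- The endomorphism `x ↦ A x` of the torus `𝕋^d = ℝ^d / ℤ^d` induced by an integer matrix `A`. -/
def toralMap {d : Type*} [Fintype d] (A : Matrix d d ℤ) (x : UnitAddTorus d) : UnitAddTorus d :=
  fun i => ∑ j, A i j • x j

/-- `toralMap A` is the map to which the linear action of `A` on `ℝ^d` projects. -/
theorem toralMap_coe {d : Type*} [Fintype d] (A : Matrix d d ℤ) (v : d → ℝ) :
    toralMap A (fun i => (v i : UnitAddCircle)) =
      fun i => (((A.map (Int.cast : ℤ → ℝ)).mulVec v i : ℝ) : UnitAddCircle) := by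
  funext i
  simp only [toralMap, Matrix.mulVec, dotProduct, Matrix.map_apply]
  rw [← QuotientAddGroup.mk'_apply (AddSubgroup.zmultiples (1 : ℝ)), map_sum]
  refine Finset.sum_congr rfl fun j _ => ?_
  rw [← zsmul_eq_mul, map_zsmul]
  rfl

theorem toralMap_mul {d : Type*} [Fintype d] (A B : Matrix d d ℤ) (x : UnitAddTorus d) :
    toralMap (A * B) x = toralMap A (toralMap B x) := by
  funext i
  simp only [toralMap, Matrix.mul_apply, Finset.sum_smul, Finset.smul_sum, mul_smul]
  exact Finset.sum_comm

theorem toralMap_one {d : Type*} [Fintype d] [DecidableEq d] (x : UnitAddTorus d) :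
    toralMap (1 : Matrix d d ℤ) x = x := by
  funext i
  simp [toralMap, Matrix.one_apply, ite_smul]

theorem continuous_toralMap {d : Type*} [Fintype d] (A : Matrix d d ℤ) :
    Continuous (toralMap A) := by
  unfold toralMap
  fun_prop

/-- The automorphism of the compact group `𝕋^d` induced by `A ∈ GL(d, ℤ)`. -/
def toralAutomorphism {d : Type*} [Fintype d] [DecidableEq d] (A : GL d ℤ) :
    UnitAddTorus d ≃ₜ+ UnitAddTorus d where
  toFun := toralMap (A : Matrix d d ℤ)
  invFun := toralMap ((A⁻¹ : GL d ℤ) : Matrix d d ℤ)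
  left_inv x := by rw [← toralMap_mul, ← Units.val_mul, inv_mul_cancel, Units.val_one, toralMap_one]
  right_inv x := by rw [← toralMap_mul, ← Units.val_mul, mul_inv_cancel, Units.val_one, toralMap_one]
  map_add' x y := by
    funext i
    simp [toralMap, Finset.sum_add_distrib]
  continuous_toFun := continuous_toralMap _
  continuous_invFun := continuous_toralMap _

/-- The matrix `W`, together with its integer inverse. -/
def waltersMatrix : GL (Fin 4) ℤ where
  val := !![0, 0, 0, -1;
            1, 0, 0,  8;
            0, 1, 0, -6;
            0, 0, 1,  8]
  inv := !![ 8, 1, 0, 0;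
            -6, 0, 1, 0;
             8, 0, 0, 1;
            -1, 0, 0, 0]
  val_inv := by decide
  inv_val := by decide

/-- `f` is `N`-mixing for `μ`: for `φ₁, …, φ_N ∈ L^∞(μ)` the products
`∏ i, φ_i ∘ f^(n₁ + ⋯ + n_i)` converge weakly in `L²(μ)` to the constant `∏ i, ∫ φ_i dμ` as all
`n_i → ∞`. Here `atTop` on `Fin N → ℕ` is generated by the sets `{n | ∀ i, K ≤ n i}`. -/
def IsNMixing {X : Type*} [MeasurableSpace X] (N : ℕ) (f : X → X) (μ : Measure X) : Prop :=
  ∀ φ : Fin N → X → ℂ, (∀ i, MemLp (φ i) ∞ μ) → ∀ ψ : X → ℂ, MemLp ψ 2 μ →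
    Tendsto
      (fun n : Fin N → ℕ => ∫ x, (∏ i, φ i (f^[∑ j ∈ Finset.Iic i, n j] x)) * ψ x ∂μ)
      atTop (𝓝 (∫ x, (∏ i, ∫ y, φ i y ∂μ) * ψ x ∂μ))

/-- The `f`-invariant probability measure `μ` is multiply mixing. -/
structure IsMultiplyMixing {X : Type*} [MeasurableSpace X] (f : X → X) (μ : Measure X) :
    Prop where
  isProbabilityMeasure : IsProbabilityMeasure μ
  measurePreserving : MeasurePreserving f μ μ
  isNMixing : ∀ N : ℕ, IsNMixing N f μ

/-! By density and uniform bounds it suffices to test characters (`tendsto_integral_prod_comp_mul`).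
A product of characters moved by powers of `W` is again a character, so its integral is 1 or 0
according to whether the total frequency `k₀ + ∑ k_i W^(n₁+⋯+n_i)` vanishes. If some frequency is
nonzero, this sum must be shown nonzero for large `n`.

Pair it with an eigenvector of `W` for a real eigenvalue `r > 1`. The characteristic polynomial is
irreducible over `ℤ`, so the pairing is injective on `ℤ^4` (`waltersPairing_eq_zero`). The sum
becomes `b + ∑ r^(n₁+⋯+n_i) a_i`, where the last nonzero `a_i` dominates
(`eventually_add_sum_pow_ne_zero`). Hyperbolicity plays no role: the other eigenvalues include a
pair on the unit circle. -/

/-! ### Reduction to a total set of test functions -/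

/-- Uniformly bounded linear functionals that tend to zero on a set with dense span tend to zero
everywhere. -/
theorem tendsto_zero_of_dense_span {E α : Type*} [NormedAddCommGroup E] [NormedSpace ℂ E]
    {l : Filter α} {S : Set E} (hS : (Submodule.span ℂ S).topologicalClosure = ⊤)
    (D : α → E →ₗ[ℂ] ℂ) (C : ℝ) (hD : ∀ n x, ‖D n x‖ ≤ C * ‖x‖)
    (h : ∀ x ∈ S, Tendsto (fun n => D n x) l (𝓝 0)) (x : E) :
    Tendsto (fun n => D n x) l (𝓝 0) := by
  have hspan : ∀ y ∈ Submodule.span ℂ S, Tendsto (fun n => D n y) l (𝓝 0) := by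
    intro y hy
    induction hy using Submodule.span_induction with
    | mem y hy => exact h y hy
    | zero => simpa using tendsto_const_nhds
    | add y z _ _ hy hz => simpa using hy.add hz
    | smul c y _ hy => simpa using hy.const_mul c
  rw [Metric.tendsto_nhds]
  intro ε hε
  have hx : x ∈ closure (Submodule.span ℂ S : Set E) := by
    rw [← Submodule.topologicalClosure_coe, hS]; trivial
  have hC : 0 < |C| + 1 := by positivity
  obtain ⟨y, hy, hxy⟩ := Metric.mem_closure_iff.1 hx (ε / 2 / (|C| + 1)) (by positivity)
  filter_upwards [Metric.tendsto_nhds.1 (hspan y hy) (ε / 2) (by positivity)] with n hn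
  rw [dist_zero_right] at hn ⊢
  rw [dist_eq_norm, lt_div_iff₀ hC] at hxy
  have h1 : ‖D n (x - y)‖ ≤ ‖x - y‖ * (|C| + 1) := by
    refine (hD n _).trans ?_
    nlinarith [le_abs_self C, norm_nonneg (x - y)]
  calc ‖D n x‖ = ‖D n (x - y) + D n y‖ := by rw [← map_add, sub_add_cancel]
    _ ≤ ‖D n (x - y)‖ + ‖D n y‖ := norm_add_le _ _
    _ < ε := by linarith

section Approximation

variable {X : Type*} [MeasurableSpace X] {μ : Measure X}

theorem MeasureTheory.MemLp.exists_ae_norm_le {f : X → ℂ} (hf : MemLp f ∞ μ) :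
    ∃ C : ℝ, 0 ≤ C ∧ ∀ᵐ x ∂μ, ‖f x‖ ≤ C := by
  refine ⟨(eLpNorm f ∞ μ).toReal, ENNReal.toReal_nonneg, ?_⟩
  have h := hf.eLpNorm_ne_top
  rw [eLpNorm_exponent_top] at h ⊢
  filter_upwards [ae_le_eLpNormEssSup (f := f) (μ := μ)] with x hx
  rw [← toReal_enorm]
  exact ENNReal.toReal_mono h hx

theorem exists_ae_norm_prod_comp_le {ι α : Type*} {T : ι → α → X → X}
    (hT : ∀ i n, MeasurePreserving (T i n) μ μ) {φ : ι → X → ℂ} (hφ : ∀ i, MemLp (φ i) ∞ μ)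
    (s : Finset ι) :
    ∃ C : ℝ, 0 ≤ C ∧ ∀ n, ∀ᵐ x ∂μ, ‖∏ i ∈ s, φ i (T i n x)‖ ≤ C := by
  choose C hC0 hC using fun i => (hφ i).exists_ae_norm_le
  refine ⟨∏ i ∈ s, C i, Finset.prod_nonneg fun i _ => hC0 i, fun n => ?_⟩
  have : ∀ᵐ x ∂μ, ∀ i ∈ s, ‖φ i (T i n x)‖ ≤ C i :=
    (Finset.eventually_all s).2 fun i _ => (hT i n).quasiMeasurePreserving.ae (hC i)
  filter_upwards [this] with x hx
  rw [norm_prod]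
  exact Finset.prod_le_prod (fun _ _ => norm_nonneg _) hx

theorem aestronglyMeasurable_prod_comp {ι α : Type*} {T : ι → α → X → X}
    (hT : ∀ i n, MeasurePreserving (T i n) μ μ) {φ : ι → X → ℂ} (hφ : ∀ i, MemLp (φ i) ∞ μ)
    (s : Finset ι) (n : α) :
    AEStronglyMeasurable (fun x => ∏ i ∈ s, φ i (T i n x)) μ :=
  Finset.aestronglyMeasurable_fun_prod s fun i _ =>
    (hφ i).aestronglyMeasurable.comp_measurePreserving (hT i n)

variable [IsProbabilityMeasure μ]

theorem integrable_mul_comp {A : X → ℂ} {C : ℝ} (hA : AEStronglyMeasurable A μ)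
    (hAC : ∀ᵐ x ∂μ, ‖A x‖ ≤ C) {T : X → X} (hT : MeasurePreserving T μ μ) {f : X → ℂ}
    (hf : MemLp f 2 μ) : Integrable (fun x => A x * f (T x)) μ :=
  ((hf.comp_measurePreserving hT).integrable one_le_two).bdd_mul hA hAC

/-- The functional `f ↦ ∫ A * f ∘ T` on `L²`, for bounded `A`. -/
noncomputable def integralMulComp {A : X → ℂ} {C : ℝ} (hA : AEStronglyMeasurable A μ)
    (hAC : ∀ᵐ x ∂μ, ‖A x‖ ≤ C) {T : X → X} (hT : MeasurePreserving T μ μ) :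
    Lp ℂ 2 μ →ₗ[ℂ] ℂ where
  toFun f := ∫ x, A x * f (T x) ∂μ
  map_add' f g := by
    rw [← integral_add (integrable_mul_comp hA hAC hT (Lp.memLp f))
      (integrable_mul_comp hA hAC hT (Lp.memLp g))]
    refine integral_congr_ae ?_
    filter_upwards [hT.quasiMeasurePreserving.ae (Lp.coeFn_add f g)] with x hx
    rw [hx, Pi.add_apply, mul_add]
  map_smul' c f := by
    rw [RingHom.id_apply, smul_eq_mul, ← integral_const_mul]
    refine integral_congr_ae ?_
    filter_upwards [hT.quasiMeasurePreserving.ae (Lp.coeFn_smul c f)] with x hx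
    rw [hx, Pi.smul_apply, smul_eq_mul]
    ring

theorem integral_norm_le_norm_Lp (f : Lp ℂ 2 μ) : ∫ x, ‖f x‖ ∂μ ≤ ‖f‖ := by
  rw [integral_norm_eq_lintegral_enorm (Lp.aestronglyMeasurable f), Lp.norm_def,
    ← eLpNorm_one_eq_lintegral_enorm]
  exact ENNReal.toReal_mono (Lp.eLpNorm_ne_top f)
    (eLpNorm_le_eLpNorm_of_exponent_le one_le_two (Lp.aestronglyMeasurable f))

theorem norm_integralMulComp_le {A : X → ℂ} {C : ℝ} (hA : AEStronglyMeasurable A μ)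
    (hAC : ∀ᵐ x ∂μ, ‖A x‖ ≤ C) {T : X → X} (hT : MeasurePreserving T μ μ) (f : Lp ℂ 2 μ) :
    ‖integralMulComp hA hAC hT f‖ ≤ C * ‖f‖ := by
  obtain ⟨x, hx⟩ := hAC.exists
  have hC : 0 ≤ C := (norm_nonneg _).trans hx
  have hi := (((Lp.memLp f).comp_measurePreserving hT).integrable one_le_two).norm
  calc ‖∫ x, A x * f (T x) ∂μ‖ ≤ ∫ x, C * ‖f (T x)‖ ∂μ := by
        refine norm_integral_le_of_norm_le (hi.const_mul C) ?_
        filter_upwards [hAC] with x hx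
        rw [norm_mul]
        gcongr
    _ = C * ∫ x, ‖f x‖ ∂μ := by
        rw [integral_const_mul]
        congr 1
        have h := integral_map (μ := μ) (φ := T) hT.aemeasurable
          (f := fun x => ‖f x‖) (by rw [hT.map_eq]; exact (Lp.aestronglyMeasurable f).norm)
        rw [hT.map_eq] at h
        exact h.symm
    _ ≤ C * ‖f‖ := by gcongr; exact integral_norm_le_norm_Lp f

/-- A limit of the form `∫ A n * f ∘ T n → c * ∫ f` extends from a total subset of `L²` to all of
`L²` if the `A n` are uniformly bounded. -/
theorem tendsto_integral_mul_comp {α : Type*} {l : Filter α} {S : Set (X → ℂ)}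
    (hS : (Submodule.span ℂ {g : Lp ℂ 2 μ | ∃ s ∈ S, g =ᵐ[μ] s}).topologicalClosure = ⊤)
    {A : α → X → ℂ} {C : ℝ} (hA : ∀ n, AEStronglyMeasurable (A n) μ)
    (hAC : ∀ n, ∀ᵐ x ∂μ, ‖A n x‖ ≤ C) {T : α → X → X}
    (hT : ∀ n, MeasurePreserving (T n) μ μ) (c : ℂ)
    (h : ∀ s ∈ S, Tendsto (fun n => ∫ x, A n x * s (T n x) ∂μ) l (𝓝 (c * ∫ x, s x ∂μ)))
    {f : X → ℂ} (hf : MemLp f 2 μ) :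
    Tendsto (fun n => ∫ x, A n x * f (T n x) ∂μ) l (𝓝 (c * ∫ x, f x ∂μ)) := by
  -- The limit is a functional of the same kind, with constant weight and identity map, so the
  -- differences are uniformly bounded by `C + ‖c‖`.
  let J := integralMulComp (μ := μ) (A := fun _ => c) (C := ‖c‖) aestronglyMeasurable_const
    (ae_of_all _ fun _ => le_rfl) (MeasurePreserving.id μ)
  have hJ : ∀ g : Lp ℂ 2 μ, J g = c * ∫ x, g x ∂μ := fun g => integral_const_mul c _
  have key := tendsto_zero_of_dense_span hS
    (l := l) (fun n => integralMulComp (hA n) (hAC n) (hT n) - J) (C + ‖c‖) (fun n g => by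
      rw [LinearMap.sub_apply, add_mul]
      exact (norm_sub_le _ _).trans
        (add_le_add (norm_integralMulComp_le _ _ _ g) (norm_integralMulComp_le _ _ _ g)))
    (by
      rintro g ⟨s, hs, hgs⟩
      refine (tendsto_sub_nhds_zero_iff.2 (h s hs)).congr fun n => ?_
      rw [LinearMap.sub_apply, hJ, integral_congr_ae hgs]
      congr 1
      refine integral_congr_ae ?_
      filter_upwards [(hT n).quasiMeasurePreserving.ae hgs] with x hx
      rw [hx]) (hf.toLp f)
  rw [← tendsto_sub_nhds_zero_iff]
  refine key.congr fun n => ?_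
  rw [LinearMap.sub_apply, hJ, integral_congr_ae hf.coeFn_toLp]
  congr 1
  refine integral_congr_ae ?_
  filter_upwards [(hT n).quasiMeasurePreserving.ae hf.coeFn_toLp] with x hx
  rw [hx]

/-- Convergence of multiple correlations need only be checked on a set of bounded functions that is
total in `L²`. -/
theorem tendsto_integral_prod_comp_mul {ι α : Type*} [Fintype ι] {l : Filter α}
    {T : ι → α → X → X} (hT : ∀ i n, MeasurePreserving (T i n) μ μ) {S : Set (X → ℂ)}
    (hS : (Submodule.span ℂ {g : Lp ℂ 2 μ | ∃ s ∈ S, g =ᵐ[μ] s}).topologicalClosure = ⊤)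
    (hSb : ∀ s ∈ S, MemLp s ∞ μ)
    (h : ∀ φ : ι → X → ℂ, (∀ i, φ i ∈ S) → ∀ ψ ∈ S,
      Tendsto (fun n => ∫ x, (∏ i, φ i (T i n x)) * ψ x ∂μ) l
        (𝓝 ((∏ i, ∫ y, φ i y ∂μ) * ∫ x, ψ x ∂μ)))
    {φ : ι → X → ℂ} (hφ : ∀ i, MemLp (φ i) ∞ μ) {ψ : X → ℂ} (hψ : MemLp ψ 2 μ) :
    Tendsto (fun n => ∫ x, (∏ i, φ i (T i n x)) * ψ x ∂μ) l
      (𝓝 ((∏ i, ∫ y, φ i y ∂μ) * ∫ x, ψ x ∂μ)) := by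
  classical
  -- Factors are freed from `S` one at a time; `t` holds the indices already freed. Meanwhile `ψ`
  -- stays in `S`, hence bounded, so the remaining factors form a bounded weight.
  have key : ∀ (t : Finset ι) (φ : ι → X → ℂ), (∀ i, MemLp (φ i) ∞ μ) → (∀ i ∉ t, φ i ∈ S) →
      ∀ ψ ∈ S, Tendsto (fun n => ∫ x, (∏ i, φ i (T i n x)) * ψ x ∂μ) l
        (𝓝 ((∏ i, ∫ y, φ i y ∂μ) * ∫ x, ψ x ∂μ)) := by
    intro t
    induction t using Finset.induction_on with
    | empty => exact fun φ _ hφS => h φ fun i => hφS i (Finset.notMem_empty i)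
    | insert a t _ ih =>
      intro φ hφ hφS ψ hψ
      obtain ⟨C, hC0, hC⟩ := exists_ae_norm_prod_comp_le hT hφ (Finset.univ.erase a)
      obtain ⟨C', -, hC'⟩ := (hSb ψ hψ).exists_ae_norm_le
      have hupd : ∀ (s : X → ℂ) (F : (X → ℂ) → ι → ℂ),
          ∏ i, F (Function.update φ a s i) i = F s a * ∏ i ∈ Finset.univ.erase a, F (φ i) i := by
        intro s F
        rw [← Finset.mul_prod_erase _ _ (Finset.mem_univ a), Function.update_self]
        congr 1
        exact Finset.prod_congr rfl fun i hi => by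
          rw [Function.update_of_ne (Finset.ne_of_mem_erase hi)]
      have step := tendsto_integral_mul_comp (l := l) hS
        (A := fun n x => (∏ i ∈ Finset.univ.erase a, φ i (T i n x)) * ψ x) (C := C * C')
        (fun n => (aestronglyMeasurable_prod_comp hT hφ _ n).mul (hSb ψ hψ).aestronglyMeasurable)
        (fun n => by
          filter_upwards [hC n, hC'] with x hx hx'
          rw [norm_mul]
          exact mul_le_mul hx hx' (norm_nonneg _) hC0)
        (hT a) ((∏ i ∈ Finset.univ.erase a, ∫ y, φ i y ∂μ) * ∫ x, ψ x ∂μ)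
        (fun s hs => by
          have := ih (Function.update φ a s)
            (fun i => by
              rcases eq_or_ne i a with rfl | hi
              · simpa using hSb s hs
              · simpa [hi] using hφ i)
            (fun i hi => by
              rcases eq_or_ne i a with rfl | hia
              · simpa using hs
              · simpa [hia] using hφS i (by simp [hia, hi])) ψ hψ
          rw [hupd s fun g _ => ∫ y, g y ∂μ] at this
          convert this using 1
          · funext n
            congr 1
            funext x
            rw [hupd s fun g i => g (T i n x)]
            ring
          · congr 1
            ring)
        ((hφ a).mono_exponent le_top)
      convert step using 1
      · funext n
        congr 1
        funext x
        rw [← Finset.mul_prod_erase _ _ (Finset.mem_univ a)]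
        ring
      · rw [← Finset.mul_prod_erase _ _ (Finset.mem_univ a)]
        congr 1
        ring
  obtain ⟨C, -, hC⟩ := exists_ae_norm_prod_comp_le hT hφ Finset.univ
  -- Only now is `ψ` freed: it may be unbounded, but all other factors are bounded.
  exact tendsto_integral_mul_comp hS (T := fun _ => id)
    (aestronglyMeasurable_prod_comp hT hφ _) hC (fun _ => MeasurePreserving.id μ) _
    (fun s hs => key Finset.univ φ hφ (fun i hi => absurd (Finset.mem_univ i) hi) s hs) hψ

end Approximation

/-! ### Characters and Haar measure on the torus -/

theorem iterate_toralMap {d : Type*} [Fintype d] [DecidableEq d] (A : Matrix d d ℤ) (m : ℕ) :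
    (toralMap A)^[m] = toralMap (A ^ m) := by
  induction m with
  | zero => funext x; simp [toralMap_one]
  | succ m ih => funext x; rw [Function.iterate_succ_apply', ih, pow_succ', toralMap_mul]

theorem UnitAddTorus.mFourier_toralMap {d : Type*} [Fintype d] (A : Matrix d d ℤ) (k : d → ℤ)
    (x : UnitAddTorus d) :
    mFourier k (toralMap A x) = mFourier (Matrix.vecMul k A) x := by
  have hsum : ∀ (s : Finset d) (g : d → UnitAddCircle),
      AddCircle.toCircle (∑ j ∈ s, g j) = ∏ j ∈ s, AddCircle.toCircle (g j) := by
    classical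
    intro s g
    induction s using Finset.induction_on with
    | empty => simp
    | insert a s ha ih => rw [Finset.sum_insert ha, Finset.prod_insert ha, AddCircle.toCircle_add, ih]
  have hprod : ∀ (k : d → ℤ) (y : UnitAddTorus d),
      mFourier k y = (AddCircle.toCircle (∑ i, k i • y i) : ℂ) := by
    intro k y
    rw [hsum]
    simp only [mFourier, ContinuousMap.coe_mk, fourier_apply]
    exact (map_prod Circle.coeHom _ _).symm
  rw [hprod, hprod]
  congr 2
  simp only [toralMap, Matrix.vecMul, dotProduct, Finset.smul_sum, Finset.sum_smul, mul_smul]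
  exact Finset.sum_comm

theorem UnitAddTorus.mFourier_sum {d ι : Type*} [Fintype d] (s : Finset ι) (k : ι → d → ℤ)
    (x : UnitAddTorus d) : mFourier (∑ i ∈ s, k i) x = ∏ i ∈ s, mFourier (k i) x := by
  classical
  induction s using Finset.induction_on with
  | empty => simp [mFourier_zero]
  | insert a s ha ih => rw [Finset.sum_insert ha, Finset.prod_insert ha, mFourier_add, ih]

theorem integral_fourier_unitAddCircle (n : ℤ) :
    ∫ x : UnitAddCircle, fourier n x = if n = 0 then (1 : ℂ) else 0 := by
  have h := orthonormal_iff_ite.1 (orthonormal_fourier (T := 1)) 0 n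
  simp only [ContinuousMap.inner_toLp, ← fourier_neg, ← fourier_add] at h
  rw [AddCircle.integral_haarAddCircle] at h
  simpa [eq_comm] using h

theorem UnitAddTorus.integral_mFourier {d : Type*} [Fintype d] (k : d → ℤ) :
    ∫ x : UnitAddTorus d, mFourier k x = if k = 0 then (1 : ℂ) else 0 := by
  simp only [mFourier, ContinuousMap.coe_mk]
  rw [integral_fintype_prod_volume_eq_prod]
  simp only [integral_fourier_unitAddCircle]
  split_ifs with h
  · simp [h]
  · obtain ⟨i, hi⟩ := Function.ne_iff.1 h
    exact Finset.prod_eq_zero (Finset.mem_univ i) (if_neg hi)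

theorem UnitAddTorus.memLp_mFourier {d : Type*} [Fintype d] (k : d → ℤ) (p : ℝ≥0∞) :
    MemLp (mFourier k) p (volume : Measure (UnitAddTorus d)) :=
  MemLp.of_bound (mFourier k).continuous.aestronglyMeasurable 1
    (ae_of_all _ fun x => ((mFourier k).norm_coe_le_norm x).trans mFourier_norm.le)

theorem UnitAddTorus.span_mFourier_dense_L2 (d : Type*) [Fintype d] :
    (Submodule.span ℂ {g : Lp ℂ 2 (volume : Measure (UnitAddTorus d)) |
      ∃ s ∈ Set.range fun k : d → ℤ => ⇑(mFourier k), g =ᵐ[volume] s}).topologicalClosure = ⊤ := by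
  have h := (ContinuousMap.toLp_denseRange ℂ (volume : Measure (UnitAddTorus d)) ℂ
    (p := 2) ENNReal.ofNat_ne_top).topologicalClosure_map_submodule
      (span_mFourier_closure_eq_top (d := d))
  rw [eq_top_iff, ← h]
  refine Submodule.topologicalClosure_mono ?_
  rw [Submodule.map_span]
  refine Submodule.span_mono ?_
  rintro _ ⟨_, ⟨k, rfl⟩, rfl⟩
  exact ⟨_, ⟨k, rfl⟩, ContinuousMap.coeFn_toLp _ _⟩

/-- A continuous surjective endomorphism of a compact group carries Haar measure to an invariant
measure of equal mass, so uniqueness applies. -/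
theorem measurePreserving_toralAutomorphism {d : Type*} [Fintype d] [DecidableEq d] (A : GL d ℤ) :
    MeasurePreserving (toralAutomorphism A) (volume : Measure (UnitAddTorus d)) volume :=
  AddMonoidHom.measurePreserving (f := (toralAutomorphism A : UnitAddTorus d →+ UnitAddTorus d))
    (toralAutomorphism A).continuous (toralAutomorphism A).surjective rfl

/-! ### Irreducibility of the characteristic polynomial -/

section Polynomial

open Polynomial

/-- This is the characteristic polynomial of `W` at `X - 1`; the shift makes it Eisenstein at 3. -/
theorem irreducible_quartic_shift :
    Irreducible (X ^ 4 - 12 * X ^ 3 + 36 * X ^ 2 - 48 * X + 24 : ℤ[X]) := by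
  have hdeg : (X ^ 4 - 12 * X ^ 3 + 36 * X ^ 2 - 48 * X + 24 : ℤ[X]).natDegree = 4 := by
    compute_degree!
  have hmonic : (X ^ 4 - 12 * X ^ 3 + 36 * X ^ 2 - 48 * X + 24 : ℤ[X]).Monic := by
    monicity!
  have hp : (Ideal.span {(3 : ℤ)}).IsPrime :=
    (Ideal.span_singleton_prime (by norm_num)).2 Int.prime_three
  suffices h : IsEisensteinAt (X ^ 4 - 12 * X ^ 3 + 36 * X ^ 2 - 48 * X + 24 : ℤ[X])
      (Ideal.span {(3 : ℤ)}) from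
    h.irreducible hp hmonic.isPrimitive (by rw [hdeg]; norm_num)
  refine ⟨?_, ?_, ?_⟩
  · rw [hmonic.leadingCoeff]
    exact hp.one_notMem
  · intro n hn
    rw [hdeg] at hn
    rw [Ideal.mem_span_singleton]
    interval_cases n <;> simp [coeff_X, coeff_ofNat_mul, coeff_X_pow]
  · rw [Ideal.span_singleton_pow, Ideal.mem_span_singleton]
    simp

/-- The irreducible quartic is, up to a unit, the minimal polynomial of `r`, and so divides no
nonzero polynomial of degree at most 3. -/
theorem eq_zero_of_cubic_root {r : ℝ} (hr : r ^ 4 - 12 * r ^ 3 + 36 * r ^ 2 - 48 * r + 24 = 0)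
    {a b c d : ℤ} (h : a + b * r + c * r ^ 2 + d * r ^ 3 = 0) :
    a = 0 ∧ b = 0 ∧ c = 0 ∧ d = 0 := by
  set p : ℤ[X] := X ^ 4 - 12 * X ^ 3 + 36 * X ^ 2 - 48 * X + 24 with hpdef
  set q : ℤ[X] := C a + C b * X + C c * X ^ 2 + C d * X ^ 3 with hqdef
  have hdeg : p.natDegree = 4 := by rw [hpdef]; compute_degree!
  have hmonic : p.Monic := by rw [hpdef]; monicity!
  have hp0 : aeval r p = 0 := by simpa [hpdef, map_ofNat] using hr
  have hq0 : aeval r q = 0 := by simpa [hqdef] using h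
  have hint : IsIntegral ℤ r := ⟨p, hmonic, by simpa [aeval_def] using hp0⟩
  have hass : Associated (minpoly ℤ r) p :=
    (minpoly.irreducible hint).associated_of_dvd irreducible_quartic_shift
      (minpoly.isIntegrallyClosed_dvd hint hp0)
  have hpq : p ∣ q := hass.dvd_iff_dvd_left.1 (minpoly.isIntegrallyClosed_dvd hint hq0)
  have hq : q = 0 := by
    refine eq_zero_of_dvd_of_natDegree_lt hpq ?_
    rw [hdeg]
    have : q.natDegree ≤ 3 := by rw [hqdef]; compute_degree
    omega
  have hc : ∀ n, q.coeff n = 0 := by simp [hq]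
  have h0 := hc 0
  have h1 := hc 1
  have h2 := hc 2
  have h3 := hc 3
  simp [hqdef, coeff_X, coeff_C, coeff_X_pow, -map_intCast, -eq_intCast] at h0 h1 h2 h3
  exact ⟨h0, h1, h2, h3⟩

end Polynomial

/-! ### The expanding eigenvalue and the pairing -/

theorem exists_root_waltersMatrix :
    ∃ r : ℝ, 1 < r ∧ r ^ 4 - 8 * r ^ 3 + 6 * r ^ 2 - 8 * r + 1 = 0 := by
  have hc : ContinuousOn (fun r : ℝ => r ^ 4 - 8 * r ^ 3 + 6 * r ^ 2 - 8 * r + 1) (Set.Icc 1 8) := by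
    fun_prop
  obtain ⟨r, hr, hr0⟩ := intermediate_value_Ioo (by norm_num) hc
    (show (0 : ℝ) ∈ Set.Ioo _ _ by norm_num)
  exact ⟨r, hr.1, hr0⟩

/-- An eigenvector of `W` for the eigenvalue `r`. -/
noncomputable def waltersEigenvector (r : ℝ) : Fin 4 → ℝ :=
  ![r ^ 3 - 8 * r ^ 2 + 6 * r - 8, r ^ 2 - 8 * r + 6, r - 8, 1]

/-- The pairing of an integer vector with the eigenvector of `W`. -/
noncomputable def waltersPairing (r : ℝ) : (Fin 4 → ℤ) →+ ℝ where
  toFun k := ∑ i, (k i : ℝ) * waltersEigenvector r i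
  map_zero' := by simp
  map_add' k l := by simp [add_mul, Finset.sum_add_distrib]

theorem waltersPairing_vecMul {r : ℝ} (hr : r ^ 4 - 8 * r ^ 3 + 6 * r ^ 2 - 8 * r + 1 = 0)
    (k : Fin 4 → ℤ) :
    waltersPairing r (Matrix.vecMul k (waltersMatrix : Matrix (Fin 4) (Fin 4) ℤ)) =
      r * waltersPairing r k := by
  simp only [waltersPairing, waltersEigenvector, waltersMatrix, Matrix.vecMul, dotProduct,
    Fin.sum_univ_four, AddMonoidHom.coe_mk, ZeroHom.coe_mk, Matrix.of_apply, Matrix.cons_val]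
  push_cast
  linear_combination (-(k 0 : ℝ)) * hr

theorem waltersPairing_vecMul_pow {r : ℝ} (hr : r ^ 4 - 8 * r ^ 3 + 6 * r ^ 2 - 8 * r + 1 = 0)
    (k : Fin 4 → ℤ) (m : ℕ) :
    waltersPairing r (Matrix.vecMul k ((waltersMatrix : Matrix (Fin 4) (Fin 4) ℤ) ^ m)) =
      r ^ m * waltersPairing r k := by
  induction m with
  | zero => simp
  | succ m ih =>
    rw [pow_succ, ← Matrix.vecMul_vecMul, waltersPairing_vecMul hr, ih]
    ring

theorem waltersPairing_eq_zero {r : ℝ} (hr : r ^ 4 - 8 * r ^ 3 + 6 * r ^ 2 - 8 * r + 1 = 0)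
    {k : Fin 4 → ℤ} (h : waltersPairing r k = 0) : k = 0 := by
  obtain ⟨h0, h1, h2, h3⟩ := eq_zero_of_cubic_root (r := r + 1)
    -- The coefficients of the pairing, re-expanded in powers of `r + 1`; they are triangular in
    -- `k`.
    (a := -23 * k 0 + 15 * k 1 - 9 * k 2 + k 3) (b := 25 * k 0 - 10 * k 1 + k 2)
    (c := -11 * k 0 + k 1) (d := k 0)
    (by linear_combination hr)
    (by
      simp [waltersPairing, waltersEigenvector, Fin.sum_univ_four] at h
      push_cast
      linear_combination h)
  funext i
  fin_cases i <;> simp <;> omega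

/-- A sum of powers `r ^ (n₁ + ⋯ + n_i)` with not all coefficients zero does not vanish when all
`n_i` are large. -/
theorem eventually_add_sum_pow_ne_zero {N : ℕ} {r : ℝ} (hr : 1 < r) {b : ℝ} {a : Fin N → ℝ}
    (h : b ≠ 0 ∨ ∃ i, a i ≠ 0) :
    ∀ᶠ n : Fin N → ℕ in atTop, b + ∑ i, r ^ (∑ j ∈ Finset.Iic i, n j) * a i ≠ 0 := by
  by_cases ha : ∃ i, a i ≠ 0
  swap
  · push Not at ha
    have hb : b ≠ 0 := h.resolve_right (by simpa using ha)
    simp [ha, hb]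
  obtain ⟨t, ht, htmax⟩ : ∃ t, a t ≠ 0 ∧ ∀ i, t < i → a i = 0 := by
    classical
    have hne : (Finset.univ.filter fun i => a i ≠ 0).Nonempty := by
      obtain ⟨i, hi⟩ := ha
      exact ⟨i, by simpa using hi⟩
    refine ⟨_, (Finset.mem_filter.1 (Finset.max'_mem _ hne)).2, fun i hi => ?_⟩
    by_contra h0
    exact absurd (Finset.le_max' _ i (by simpa using h0)) (not_le.2 hi)
  set c := |b| + ∑ i, |a i| with hc
  -- Terms before `t` have exponent at most `M = ∑ j < t, n j` and those after vanish, so the rest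
  -- is at most `r^M * c`. The `t` term has the extra factor `r^(n t)`, which beats `c / |a t|` once
  -- `n t ≥ K`.
  obtain ⟨K, hK⟩ := pow_unbounded_of_one_lt (c / |a t|) hr
  rw [div_lt_iff₀ (abs_pos.2 ht)] at hK
  filter_upwards [eventually_ge_atTop (fun _ => K)] with n hn h0
  set M := ∑ j ∈ Finset.Iio t, n j with hM
  have hMt : ∑ j ∈ Finset.Iic t, n j = n t + M := by
    rw [← Finset.Iio_insert, Finset.sum_insert (by simp)]
  rw [← Finset.add_sum_erase _ _ (Finset.mem_univ t), hMt] at h0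
  have hrest : |b + ∑ i ∈ Finset.univ.erase t, r ^ (∑ j ∈ Finset.Iic i, n j) * a i| ≤ r ^ M * c := by
    have h1 : 1 ≤ r ^ M := one_le_pow₀ hr.le
    rw [hc, mul_add, Finset.mul_sum]
    refine (abs_add_le _ _).trans (add_le_add ?_ ((Finset.abs_sum_le_sum_abs _ _).trans ?_))
    · exact le_mul_of_one_le_left (abs_nonneg b) h1
    · refine (Finset.sum_le_sum fun i hi => ?_).trans
        (Finset.sum_le_sum_of_subset_of_nonneg (Finset.erase_subset t _)
          fun i _ _ => mul_nonneg (by positivity) (abs_nonneg (a i)))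
      rw [abs_mul, abs_of_pos (by positivity)]
      rcases lt_or_gt_of_ne (Finset.ne_of_mem_erase hi) with hit | hit
      · refine mul_le_mul_of_nonneg_right (pow_le_pow_right₀ hr.le ?_) (abs_nonneg _)
        exact Finset.sum_le_sum_of_subset fun j hj =>
          Finset.mem_Iio.2 ((Finset.mem_Iic.1 hj).trans_lt hit)
      · simp [htmax i hit]
  have hrM : 0 < r ^ M := by positivity
  have hlt : r ^ M * c < |r ^ (n t + M) * a t| := by
    rw [abs_mul, abs_of_pos (by positivity : 0 < r ^ (n t + M)), pow_add, mul_comm (r ^ n t),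
      mul_assoc]
    refine mul_lt_mul_of_pos_left (hK.trans_le ?_) hrM
    exact mul_le_mul_of_nonneg_right (pow_le_pow_right₀ hr.le (hn t)) (abs_nonneg _)
  refine (hrest.trans_lt hlt).ne ?_
  rw [← abs_neg]
  congr 1
  linarith

/-! ### Correlations of characters and conclusion -/

theorem isProbabilityMeasure_unitAddTorus (d : Type*) [Fintype d] :
    IsProbabilityMeasure (volume : Measure (UnitAddTorus d)) :=
  haveI : IsProbabilityMeasure (volume : Measure UnitAddCircle) := ⟨UnitAddCircle.measure_univ⟩
  inferInstanceAs (IsProbabilityMeasure (Measure.pi fun _ : d => (volume : Measure UnitAddCircle)))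

open UnitAddTorus in
/-- Multiple correlations of characters along `F_W` are eventually equal to their limit. -/
theorem eventually_integral_prod_mFourier_eq {N : ℕ} (k : Fin N → Fin 4 → ℤ) (k₀ : Fin 4 → ℤ) :
    ∀ᶠ n : Fin N → ℕ in atTop,
      ∫ x, (∏ i, mFourier (k i)
        ((toralAutomorphism waltersMatrix)^[∑ j ∈ Finset.Iic i, n j] x)) * mFourier k₀ x =
      (∏ i, ∫ y, mFourier (k i) y) * ∫ x, mFourier k₀ x := by
  obtain ⟨r, hr1, hr⟩ := exists_root_waltersMatrix
  let W : Matrix (Fin 4) (Fin 4) ℤ := waltersMatrix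
  let freq (n : Fin N → ℕ) : Fin 4 → ℤ :=
    (∑ i, Matrix.vecMul (k i) (W ^ (∑ j ∈ Finset.Iic i, n j))) + k₀
  have hint (n : Fin N → ℕ) :
      ∫ x, (∏ i, mFourier (k i)
        ((toralAutomorphism waltersMatrix)^[∑ j ∈ Finset.Iic i, n j] x)) * mFourier k₀ x =
      if freq n = 0 then (1 : ℂ) else 0 := by
    rw [← integral_mFourier]
    congr 1
    funext x
    rw [mFourier_add, mFourier_sum]
    congr 1
    refine Finset.prod_congr rfl fun i _ => ?_
    rw [← mFourier_toralMap, ← iterate_toralMap]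
    rfl
  simp only [hint, integral_mFourier]
  by_cases h : k₀ = 0 ∧ ∀ i, k i = 0
  · simp [freq, h.1, h.2]
  have h' : waltersPairing r k₀ ≠ 0 ∨ ∃ i, waltersPairing r (k i) ≠ 0 := by
    contrapose! h
    exact ⟨waltersPairing_eq_zero hr h.1, fun i => waltersPairing_eq_zero hr (h.2 i)⟩
  filter_upwards [eventually_add_sum_pow_ne_zero hr1 h'] with n hn
  rw [if_neg]
  · rcases not_and_or.1 h with h | h
    · rw [if_neg h, mul_zero]
    · obtain ⟨i, hi⟩ := not_forall.1 h
      rw [Finset.prod_eq_zero (Finset.mem_univ i) (if_neg hi), zero_mul]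
  · intro h0
    apply hn
    have := congrArg (waltersPairing r) h0
    rw [map_add, map_sum, map_zero] at this
    simp only [W, waltersPairing_vecMul_pow hr] at this
    rw [add_comm]
    exact this

theorem mainTheorem9 :
    IsMultiplyMixing (toralAutomorphism waltersMatrix)
      (volume : Measure (UnitAddTorus (Fin 4))) where
  isProbabilityMeasure := isProbabilityMeasure_unitAddTorus _
  measurePreserving := measurePreserving_toralAutomorphism waltersMatrix
  isNMixing N φ hφ ψ hψ := by
    rw [integral_const_mul]
    have := isProbabilityMeasure_unitAddTorus (Fin 4)
    refine tendsto_integral_prod_comp_mul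
      (T := fun i (n : Fin N → ℕ) => (toralAutomorphism waltersMatrix)^[∑ j ∈ Finset.Iic i, n j])
      (fun i n => (measurePreserving_toralAutomorphism waltersMatrix).iterate _)
      (UnitAddTorus.span_mFourier_dense_L2 (Fin 4)) ?_ ?_ hφ hψ
    · rintro _ ⟨k, rfl⟩
      exact UnitAddTorus.memLp_mFourier k ∞
    · rintro χ hχ _ ⟨k₀, rfl⟩
      choose k hk using hχ
      obtain rfl : (fun i => ⇑(UnitAddTorus.mFourier (k i))) = χ := funext hk
      exact tendsto_nhds_of_eventually_eq (eventually_integral_prod_mFourier_eq k k₀)
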